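/- Let $q,\rho$ be real with $|q|<1$ and $|\rho|<1$, and let $x\in S(q)=\left[-\frac{2}{\sqrt{1-q}},\frac{2}{\sqrt{1-q}}\right]$. Write $[n]_q=1+q+\dots+q^{n-1}$, $[n]_q!=\prod_{j=1}^{n}[j]_q$, $(a)_\infty=\prod_{j=0}^{\infty}(1-aq^j)$ (with $0^0=1$), and $$L_k(x,\rho|q)=(1+\rho q^k)^2-(1-q)x^2\rho q^k .$$ Let $H_n(x|q)$ be the $q$-Hermite polynomials, defined by $H_0(x|q)=1$, $H_1(x|q)=x$ and $H_{n+1}(x|q)=xH_n(x|q)-[n]_qH_{n-1}(x|q)$ for $n\ge 1$. Then all the infinite products below converge, $(\rho)_\infty\neq 0$, every $[k]_q!$ and every $L_k(x,\rho|q)$ is nonzero, the series converges absolutely, and $$\sum_{k\ge 0}\frac{\rho^k\,(\rho q^{k+1})_\infty}{[k]_q!}\,H_{2k}(x|q)=\frac{(\rho^2)_\infty}{(\rho)_\infty}\prod_{k=0}^{\infty}L_k(x,\rho|q)^{-1}.$$ -/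

import Mathlib

open Finset

/-- The `q`-number `[n]_q = 1 + q + ⋯ + q ^ (n - 1)`, with `[0]_q = 0`. -/
def qNumber (q : ℝ) (n : ℕ) : ℝ := ∑ i ∈ range n, q ^ i

/-- The `q`-factorial `[n]_q! = [1]_q [2]_q ⋯ [n]_q`, with `[0]_q! = 1`. -/
def qFactorial (q : ℝ) (n : ℕ) : ℝ := ∏ j ∈ range n, qNumber q (j + 1)

/-- The infinite `q`-Pochhammer symbol `(a; q)_∞ = ∏_{j ≥ 0} (1 - a q ^ j)`. -/
noncomputable def qPochhammerInf (a q : ℝ) : ℝ := ∏' j : ℕ, (1 - a * q ^ j)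

/-- The set `S(q)`: the interval `[-2 / √(1 - q), 2 / √(1 - q)]` for `|q| < 1`,
and the whole line for `q = 1`. -/
noncomputable def qSupport (q : ℝ) : Set ℝ :=
  if |q| < 1 then Set.Icc (-(2 / √(1 - q))) (2 / √(1 - q)) else Set.univ

/-- The continuous `q`-Hermite polynomials `h_n(x|q)` in the normalization orthogonal on `[-1, 1]`:
`h_0 = 1`, `h_1 = 2 x`, `h_{n+1} = 2 x h_n - (1 - q ^ n) h_{n-1}`. -/
def qHermiteLower (q x : ℝ) : ℕ → ℝ
  | 0 => 1
  | 1 => 2 * x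
  | n + 2 => 2 * x * qHermiteLower q x (n + 1) - (1 - q ^ (n + 1)) * qHermiteLower q x n

/-- The `q`-Hermite polynomials `H_n(x|q)` in the normalization orthogonal on `S(q)`:
`H_0 = 1`, `H_1 = x`, `H_{n+1} = x H_n - [n]_q H_{n-1}`. -/
def qHermite (q x : ℝ) : ℕ → ℝ
  | 0 => 1
  | 1 => x
  | n + 2 => x * qHermite q x (n + 1) - qNumber q (n + 1) * qHermite q x n

/-- The two normalizations are related by
`H_n(x|q) = (1 - q) ^ (-n / 2) h_n(x √(1 - q) / 2 | q)`. -/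
theorem qHermite_eq_qHermiteLower {q : ℝ} (hq : q < 1) (x : ℝ) (n : ℕ) :
    qHermite q x n = qHermiteLower q (x * √(1 - q) / 2) n / √(1 - q) ^ n := by
  have h1 : 0 < 1 - q := by linarith
  have hs : √(1 - q) ≠ 0 := (Real.sqrt_pos.mpr h1).ne'
  have hsq : √(1 - q) ^ 2 = 1 - q := Real.sq_sqrt h1.le
  have key : ∀ m, qNumber q m * √(1 - q) ^ 2 = 1 - q ^ m := by
    intro m
    rw [hsq, qNumber, geom_sum_mul_neg]
  induction n using Nat.strong_induction_on with
  | _ n ih =>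
    match n with
    | 0 => simp [qHermite, qHermiteLower]
    | 1 =>
      simp only [qHermite, qHermiteLower]
      field_simp
    | n + 2 =>
      simp only [qHermite, qHermiteLower]
      rw [ih (n + 1) (by omega), ih n (by omega), ← key (n + 1)]
      field_simp
      ring

/-- The quadratic polynomials `L_k(x, a|q) = (1 + a q ^ k) ^ 2 - (1 - q) x ^ 2 a q ^ k`. For
`x = 2 cos θ / √(1 - q)` this is `(1 - a q ^ k exp (2 i θ)) (1 - a q ^ k exp (-2 i θ))`. -/
def qL (q x a : ℝ) (k : ℕ) : ℝ := (1 + a * q ^ k) ^ 2 - (1 - q) * x ^ 2 * a * q ^ k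

open Filter Topology

/-! ### Infinite products and uniform bounds -/

section Pochhammer

variable {q : ℝ}

/-! Rescale x to X in [-1, 1] and view the series as a function F(a) of a = ρ. The recurrence for
h_n makes partial sums telescope (`sum_qExpansionTerm_telescope`), so ((1+a)² - 4X²a) F(a) = (1+a)(1
- qa²) F(aq), provided the boundary terms vanish; this and convergence rest on subexponential growth
of h_n on [-1, 1]. Multiplying by 1 - a turns the right factor into (1 - a²)(1 - qa²), two
consecutive factors of (a²)_∞. Iterating along a, aq, aq², …, with F(aqⁿ) → 1, gives the product
formula. -/

theorem summable_norm_mul_pow (hq : |q| < 1) (a : ℝ) : Summable fun j : ℕ => ‖a * q ^ j‖ :=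
  ((summable_geometric_of_abs_lt_one hq).mul_left a).norm

theorem multipliable_one_sub_mul_pow (hq : |q| < 1) (a : ℝ) :
    Multipliable fun j : ℕ => 1 - a * q ^ j := by
  simpa [sub_eq_add_neg] using
    multipliable_one_add_of_summable (f := fun j : ℕ => -(a * q ^ j))
      (by simpa only [norm_neg] using summable_norm_mul_pow hq a)

theorem abs_mul_pow_lt_one {a : ℝ} (hq : |q| < 1) (ha : |a| < 1) (n : ℕ) : |a * q ^ n| < 1 := by
  rw [abs_mul, abs_pow]
  exact (mul_le_of_le_one_right (abs_nonneg a) (pow_le_one₀ (abs_nonneg q) hq.le)).trans_lt ha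

theorem one_sub_mul_pow_ne_zero {a : ℝ} (hq : |q| < 1) (ha : |a| < 1) (n : ℕ) :
    1 - a * q ^ n ≠ 0 := by
  have := (abs_lt.mp (abs_mul_pow_lt_one hq ha n)).2
  linarith

theorem qPochhammerInf_ne_zero {a : ℝ} (hq : |q| < 1) (ha : |a| < 1) :
    qPochhammerInf a q ≠ 0 := by
  have := tprod_one_add_ne_zero_of_summable (f := fun j : ℕ => -(a * q ^ j))
    (fun j => by simpa [sub_eq_add_neg] using one_sub_mul_pow_ne_zero hq ha j)
    (by simpa only [norm_neg] using summable_norm_mul_pow hq a)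
  simpa [qPochhammerInf, sub_eq_add_neg] using this

theorem tendsto_prod_qPochhammerInf (hq : |q| < 1) (a : ℝ) :
    Tendsto (fun n => ∏ j ∈ range n, (1 - a * q ^ j)) atTop (𝓝 (qPochhammerInf a q)) :=
  (multipliable_one_sub_mul_pow hq a).hasProd.tendsto_prod_nat

theorem qPochhammerInf_eq_one_sub_mul (hq : |q| < 1) (a : ℝ) :
    qPochhammerInf a q = (1 - a) * qPochhammerInf (a * q) q := by
  refine tendsto_nhds_unique
    ((tendsto_prod_qPochhammerInf hq a).comp (tendsto_add_atTop_nat 1))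
    (((tendsto_prod_qPochhammerInf hq (a * q)).const_mul (1 - a)).congr fun n => ?_)
  rw [Function.comp_apply, prod_range_succ', pow_zero, mul_one, mul_comm]
  simp only [pow_succ', mul_assoc]

theorem qPochhammerInf_eq_prod_mul (hq : |q| < 1) (a : ℝ) (n : ℕ) :
    qPochhammerInf a q =
      (∏ j ∈ range n, (1 - a * q ^ j)) * qPochhammerInf (a * q ^ n) q := by
  induction n with
  | zero => simp
  | succ n ih =>
    rw [ih, qPochhammerInf_eq_one_sub_mul hq (a * q ^ n), prod_range_succ, pow_succ]
    ring_nf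

/-- The tail is the full product divided by its n-th partial product, and the full product is
nonzero. -/
theorem tendsto_qPochhammerInf_mul_pow {a : ℝ} (hq : |q| < 1) (ha : |a| < 1) :
    Tendsto (fun n : ℕ => qPochhammerInf (a * q ^ n) q) atTop (𝓝 1) := by
  have h0 := qPochhammerInf_ne_zero hq ha
  have h := (tendsto_const_nhds (x := qPochhammerInf a q)).div
    (tendsto_prod_qPochhammerInf hq a) h0
  rw [div_self h0] at h
  refine h.congr fun n => ?_
  rw [Pi.div_apply, qPochhammerInf_eq_prod_mul hq a n, mul_div_cancel_left₀]
  exact prod_ne_zero_iff.mpr fun j _ => one_sub_mul_pow_ne_zero hq ha j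

theorem exists_abs_qPochhammerInf_mul_pow_le {a : ℝ} (hq : |q| < 1) (ha : |a| < 1) :
    ∃ C, ∀ n : ℕ, |qPochhammerInf (a * q ^ n) q| ≤ C := by
  obtain ⟨C, hC⟩ := isBounded_iff_forall_norm_le.mp
    (Metric.isBounded_range_of_tendsto _ (tendsto_qPochhammerInf_mul_pow hq ha))
  exact ⟨C, fun n => hC _ ⟨n, rfl⟩⟩

/-- The finite `q`-Pochhammer symbol `(q; q)_n = (1 - q) (1 - q ^ 2) ⋯ (1 - q ^ n)`. -/
def qPochhammerSelf (q : ℝ) (n : ℕ) : ℝ := ∏ j ∈ range n, (1 - q * q ^ j)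

theorem qPochhammerSelf_succ (q : ℝ) (n : ℕ) :
    qPochhammerSelf q (n + 1) = qPochhammerSelf q n * (1 - q * q ^ n) := prod_range_succ _ _

theorem qPochhammerSelf_ne_zero (hq : |q| < 1) (n : ℕ) : qPochhammerSelf q n ≠ 0 :=
  prod_ne_zero_iff.mpr fun j _ => one_sub_mul_pow_ne_zero hq hq j

theorem qFactorial_mul_pow (q : ℝ) (n : ℕ) :
    qFactorial q n * (1 - q) ^ n = qPochhammerSelf q n := by
  rw [qFactorial, qPochhammerSelf, ← card_range n, ← prod_const, card_range, ← prod_mul_distrib]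
  refine prod_congr rfl fun j _ => ?_
  rw [qNumber, geom_sum_mul_neg, pow_succ']

theorem qFactorial_ne_zero (hq : |q| < 1) (n : ℕ) : qFactorial q n ≠ 0 := by
  have h := qPochhammerSelf_ne_zero hq n
  rw [← qFactorial_mul_pow] at h
  exact left_ne_zero_of_mul h

theorem exists_abs_inv_qPochhammerSelf_le (hq : |q| < 1) :
    ∃ D, ∀ n : ℕ, |(qPochhammerSelf q n)⁻¹| ≤ D := by
  obtain ⟨C, hC⟩ := isBounded_iff_forall_norm_le.mp
    (Metric.isBounded_range_of_tendsto _
      ((tendsto_prod_qPochhammerInf hq q).inv₀ (qPochhammerInf_ne_zero hq hq)))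
  exact ⟨C, fun n => hC _ ⟨n, rfl⟩⟩

end Pochhammer

/-! ### The factors L_k -/

section Quadratic

variable {q x : ℝ}

theorem sq_le_of_mem_qSupport (hq : |q| < 1) (hx : x ∈ qSupport q) : (1 - q) * x ^ 2 ≤ 4 := by
  have h1 : 0 < 1 - q := by linarith [(abs_lt.mp hq).2]
  rw [qSupport, if_pos hq, Set.mem_Icc, ← abs_le, le_div_iff₀ (Real.sqrt_pos.mpr h1)] at hx
  have h2 := pow_le_pow_left₀ (by positivity) hx 2
  rw [mul_pow, sq_abs, Real.sq_sqrt h1.le] at h2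
  linarith

/-- With b = aq^k, the value is affine in (1-q)x² ∈ [0, 4], with endpoint values (1+b)² and (1-b)²,
both positive. -/
theorem qL_pos {a : ℝ} (hq : |q| < 1) (ha : |a| < 1) (hx : x ∈ qSupport q) (k : ℕ) :
    0 < qL q x a k := by
  have h4 := sq_le_of_mem_qSupport hq hx
  have h0 : 0 ≤ (1 - q) * x ^ 2 := mul_nonneg (by linarith [(abs_lt.mp hq).2]) (sq_nonneg x)
  have hb := abs_lt.mp (abs_mul_pow_lt_one hq ha k)
  rw [qL, mul_assoc _ a]
  generalize a * q ^ k = b at hb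
  rcases le_total b 0 with h | h
  · have h5 : 0 < (1 + b) ^ 2 := pow_pos (by linarith [hb.1]) 2
    linarith [mul_nonpos_of_nonneg_of_nonpos h0 h]
  · have h5 : 0 < (1 - b) ^ 2 := pow_pos (by linarith [hb.2]) 2
    linarith [mul_le_mul_of_nonneg_right h4 h]

theorem summable_norm_qL_sub_one (hq : |q| < 1) (x a : ℝ) :
    Summable fun k : ℕ => ‖qL q x a k - 1‖ := by
  have hq2 : |q ^ 2| < 1 := by
    rw [abs_pow]
    exact pow_lt_one₀ (abs_nonneg q) hq two_ne_zero
  have h := ((summable_geometric_of_abs_lt_one hq).mul_left (2 * a - (1 - q) * x ^ 2 * a)).add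
    ((summable_geometric_of_abs_lt_one hq2).mul_left (a ^ 2))
  refine (h.congr fun k => ?_).norm
  rw [qL]
  ring

theorem multipliable_qL (hq : |q| < 1) (x a : ℝ) : Multipliable fun k : ℕ => qL q x a k := by
  simpa using multipliable_one_add_of_summable (summable_norm_qL_sub_one hq x a)

theorem tprod_qL_ne_zero {a : ℝ} (hq : |q| < 1) (ha : |a| < 1) (hx : x ∈ qSupport q) :
    ∏' k : ℕ, qL q x a k ≠ 0 := by
  simpa using tprod_one_add_ne_zero_of_summable
    (fun k => by simpa using (qL_pos hq ha hx k).ne') (summable_norm_qL_sub_one hq x a)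

end Quadratic

/-! ### Growth of the q-Hermite polynomials -/

section Growth

variable {q X : ℝ}

/-- Two mutually inverse complex numbers of modulus one with sum `2 X`, for `X ∈ [-1, 1]`. -/
theorem exists_norm_eq_one_add_eq_two_mul (hX : |X| ≤ 1) :
    ∃ z w : ℂ, ‖z‖ = 1 ∧ ‖w‖ = 1 ∧ z * w = 1 ∧ z + w = 2 * X := by
  refine ⟨Complex.exp (Real.arccos X * Complex.I), Complex.exp (-(Real.arccos X) * Complex.I),
    Complex.norm_exp_ofReal_mul_I _, ?_, ?_, ?_⟩
  · simpa using Complex.norm_exp_ofReal_mul_I (-(Real.arccos X))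
  · rw [← Complex.exp_add]
    simp
  · have hc := Complex.two_cos (Real.arccos X : ℂ)
    rw [← hc, ← Complex.ofReal_cos, Real.cos_arccos (abs_le.mp hX).1 (abs_le.mp hX).2]

/-- On `[-1, 1]` the polynomials `h_n(X|q)` grow subexponentially. -/
theorem summable_pow_mul_abs_qHermiteLower (hq : |q| < 1) (hX : |X| ≤ 1) {r : ℝ}
    (hr0 : 0 ≤ r) (hr : r < 1) : Summable fun n : ℕ => r ^ n * |qHermiteLower q X n| := by
  obtain ⟨z, w, hz, hw, hzw, hzw'⟩ := exists_norm_eq_one_add_eq_two_mul hX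
  set h : ℕ → ℂ := fun n => (qHermiteLower q X n : ℂ) with hh
  have hrec : ∀ n, h (n + 2) = (z + w) * h (n + 1) - (1 - q ^ (n + 1)) * h n := by
    intro n
    rw [hzw']
    simp [hh, qHermiteLower]
  -- Factoring the limiting recurrence (q^n replaced by 0) as (shift - w)(shift - z) leaves a
  -- first-order recurrence for d with error q^(n+1) h_n.
  set d : ℕ → ℂ := fun n => h (n + 1) - z * h n with hd
  have hdrec : ∀ n, d (n + 1) = w * d n + q ^ (n + 1) * h n := by
    intro n
    simp only [hd, hrec]
    linear_combination h n * hzw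
  have hd1 : ∀ n, ‖d (n + 1)‖ ≤ ‖d n‖ + |q| ^ (n + 1) * ‖h n‖ := by
    intro n
    rw [hdrec]
    refine (norm_add_le _ _).trans_eq ?_
    simp [hw]
  have hh1 : ∀ n, ‖h (n + 1)‖ ≤ ‖h n‖ + ‖d n‖ := by
    intro n
    have : h (n + 1) = z * h n + d n := by simp [hd]
    rw [this]
    refine (norm_add_le _ _).trans_eq ?_
    simp [hz]
  obtain ⟨e, he, her⟩ : ∃ e : ℝ, 0 < e ∧ r * (1 + e) < 1 :=
    ⟨(1 - r) / 2, by linarith, by nlinarith⟩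
  have hq' : ∀ᶠ n : ℕ in atTop, |q| ^ (n + 1) < e * e :=
    ((tendsto_pow_atTop_nhds_zero_of_lt_one (abs_nonneg q) hq).comp
      (tendsto_add_atTop_nat 1)).eventually_lt_const (by positivity)
  have hS : Summable fun n : ℕ => r ^ n * (e * ‖h n‖ + ‖d n‖) := by
    refine summable_of_ratio_norm_eventually_le her ?_
    filter_upwards [hq'] with n hn
    have hp : 0 ≤ r ^ n := pow_nonneg hr0 n
    rw [Real.norm_of_nonneg (by positivity), Real.norm_of_nonneg (by positivity), pow_succ]
    -- The weight e balances the two bounds: once |q|^(n+1) < e², the combined size grows by a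
    -- factor of at most 1 + e.
    have key : e * ‖h (n + 1)‖ + ‖d (n + 1)‖ ≤ (1 + e) * (e * ‖h n‖ + ‖d n‖) := by
      have h1 := mul_le_mul_of_nonneg_left (hh1 n) he.le
      have h2 := mul_le_mul_of_nonneg_right hn.le (norm_nonneg (h n))
      linarith [hd1 n]
    calc r ^ n * r * (e * ‖h (n + 1)‖ + ‖d (n + 1)‖)
        ≤ r ^ n * r * ((1 + e) * (e * ‖h n‖ + ‖d n‖)) :=
          mul_le_mul_of_nonneg_left key (by positivity)
      _ = _ := by ring
  refine Summable.of_nonneg_of_le (fun n => by positivity) (fun n => ?_) (hS.mul_left e⁻¹)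
  have hn : ‖h n‖ = |qHermiteLower q X n| := by simp [hh]
  have hp : 0 ≤ r ^ n := pow_nonneg hr0 n
  rw [← hn]
  calc r ^ n * ‖h n‖ = e⁻¹ * (r ^ n * (e * ‖h n‖)) := by field_simp
    _ ≤ _ := by
      have : e * ‖h n‖ ≤ e * ‖h n‖ + ‖d n‖ := le_add_of_nonneg_right (norm_nonneg _)
      gcongr

theorem summable_pow_mul_abs_qHermiteLower_even (hq : |q| < 1) (hX : |X| ≤ 1) {r : ℝ}
    (hr0 : 0 ≤ r) (hr : r < 1) : Summable fun k : ℕ => r ^ k * |qHermiteLower q X (2 * k)| := by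
  have h := summable_pow_mul_abs_qHermiteLower hq hX (Real.sqrt_nonneg r)
    ((Real.sqrt_lt' one_pos).mpr (by simpa using hr))
  refine (h.comp_injective (mul_right_injective₀ (two_ne_zero (α := ℕ)))).congr fun k => ?_
  simp [pow_mul, Real.sq_sqrt hr0]

end Growth

/-! ### Functional equation and its iteration -/

section Expansion

variable {q X a : ℝ}

/-- The `k`-th term of the expansion, in terms of the polynomials `h_n(X|q)`. -/
noncomputable def qExpansionTerm (q X a : ℝ) (k : ℕ) : ℝ :=
  a ^ k * qPochhammerInf (a * q ^ (k + 1)) q * (qPochhammerSelf q k)⁻¹ *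
    qHermiteLower q X (2 * k)

theorem exists_abs_coeff_le (hq : |q| < 1) (ha : |a| < 1) :
    ∃ C, ∀ m k : ℕ, |qPochhammerInf (a * q ^ m) q * (qPochhammerSelf q k)⁻¹| ≤ C := by
  obtain ⟨C, hC⟩ := exists_abs_qPochhammerInf_mul_pow_le hq ha
  obtain ⟨D, hD⟩ := exists_abs_inv_qPochhammerSelf_le hq
  refine ⟨C * D, fun m k => ?_⟩
  rw [abs_mul]
  exact mul_le_mul (hC m) (hD k) (abs_nonneg _) ((abs_nonneg _).trans (hC m))

theorem summable_qExpansionTerm (hq : |q| < 1) (hX : |X| ≤ 1) (ha : |a| < 1) :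
    Summable (qExpansionTerm q X a) := by
  obtain ⟨C, hC⟩ := exists_abs_coeff_le hq ha
  refine Summable.of_norm_bounded
    ((summable_pow_mul_abs_qHermiteLower_even hq hX (abs_nonneg a) ha).mul_left C) fun k => ?_
  rw [qExpansionTerm, mul_assoc (a ^ k), Real.norm_eq_abs, abs_mul, abs_mul, abs_pow,
    mul_comm (|a| ^ k), mul_assoc]
  exact mul_le_mul_of_nonneg_right (hC _ _) (by positivity)

/-- Eliminates the odd degrees from three consecutive recurrences. -/
theorem qHermiteLower_two_step (q X : ℝ) (k : ℕ) :
    4 * X ^ 2 * qHermiteLower q X (2 * k + 2) =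
      qHermiteLower q X (2 * k + 4) +
        (2 - q ^ (2 * k + 2) - q ^ (2 * k + 3)) * qHermiteLower q X (2 * k + 2) +
        (1 - q ^ (2 * k + 2)) * (1 - q ^ (2 * k + 1)) * qHermiteLower q X (2 * k) := by
  have h4 : qHermiteLower q X (2 * k + 4) = 2 * X * qHermiteLower q X (2 * k + 3) -
    (1 - q ^ (2 * k + 3)) * qHermiteLower q X (2 * k + 2) := rfl
  have h3 : qHermiteLower q X (2 * k + 3) = 2 * X * qHermiteLower q X (2 * k + 2) -
    (1 - q ^ (2 * k + 2)) * qHermiteLower q X (2 * k + 1) := rfl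
  have h2 : qHermiteLower q X (2 * k + 2) = 2 * X * qHermiteLower q X (2 * k + 1) -
    (1 - q ^ (2 * k + 1)) * qHermiteLower q X (2 * k) := rfl
  linear_combination -h4 - 2 * X * h3 - (1 - q ^ (2 * k + 2)) * h2

theorem sum_qExpansionTerm_telescope (hq : |q| < 1) (X a : ℝ) (n : ℕ) :
    ∑ k ∈ range (n + 1), (((1 + a) ^ 2 - 4 * X ^ 2 * a) * qExpansionTerm q X a k -
        (1 + a) * (1 - q * a ^ 2) * qExpansionTerm q X (a * q) k) =
      (1 - q ^ (2 * n + 2)) * (1 - q ^ (2 * n + 1)) * a ^ 2 *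
          (a ^ n * (qPochhammerInf (a * q ^ (n + 2)) q * (qPochhammerSelf q (n + 1))⁻¹) *
            qHermiteLower q X (2 * n)) -
        a ^ (n + 1) * (qPochhammerInf (a * q ^ (n + 1)) q * (qPochhammerSelf q n)⁻¹) *
          qHermiteLower q X (2 * n + 2) := by
  have hA : ∀ m : ℕ, qPochhammerInf (a * q ^ m) q =
      (1 - a * q ^ m) * qPochhammerInf (a * q ^ (m + 1)) q := fun m => by
    rw [qPochhammerInf_eq_one_sub_mul hq, pow_succ, mul_assoc a]
  have hshift : ∀ m : ℕ, a * q * q ^ m = a * q ^ (m + 1) := fun m => by ring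
  induction n with
  | zero =>
    have h0 : (1 - q) ≠ 0 := by simpa using one_sub_mul_pow_ne_zero hq hq 0
    simp only [zero_add, range_one, sum_singleton, qExpansionTerm, hshift, mul_zero, qHermiteLower,
      qPochhammerSelf_succ, hA 1]
    simp only [qPochhammerSelf, range_zero, prod_empty]
    norm_num
    field_simp
    ring
  | succ n ih =>
    rw [sum_range_succ, ih]
    have h0 := qPochhammerSelf_ne_zero hq n
    have h1 := one_sub_mul_pow_ne_zero hq hq n
    have h2 := one_sub_mul_pow_ne_zero hq hq (n + 1)
    have hH := qHermiteLower_two_step q X n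
    simp only [qExpansionTerm, hshift]
    rw [show 2 * (n + 1) = 2 * n + 2 by ring, show n + 1 + 1 = n + 2 by ring,
      show n + 1 + 2 = n + 3 by ring, show 2 * n + 2 + 2 = 2 * n + 4 by ring,
      show 2 * n + 2 + 1 = 2 * n + 3 by ring, show n + 2 + 1 = n + 3 by ring,
      hA (n + 1), hA (n + 2), qPochhammerSelf_succ q (n + 1), qPochhammerSelf_succ q n]
    generalize qPochhammerInf (a * q ^ (n + 3)) q = P
    generalize qHermiteLower q X (2 * n + 4) = H4 at *
    generalize qHermiteLower q X (2 * n + 2) = H2 at *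
    generalize qHermiteLower q X (2 * n) = H0 at *
    generalize qPochhammerSelf q n = Q at *
    have hq2 : ∀ m, q ^ (2 * n + m) = (q ^ n) ^ 2 * q ^ m := fun m => by ring
    clear ih
    simp only [mul_pow, pow_add q n, pow_add a n, hq2] at hH h1 h2 ⊢
    generalize q ^ n = t at *
    generalize a ^ n = b at *
    simp only [pow_one] at h2 ⊢
    obtain ⟨u, hu⟩ : ∃ u, u = 1 - q * t := ⟨_, rfl⟩
    obtain ⟨v, hv⟩ : ∃ v, v = 1 - q * (t * q) := ⟨_, rfl⟩
    rw [← hu] at h1 ⊢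
    rw [← hv] at h2 ⊢
    -- The multiplier of the two-step recurrence is -a times the coefficient of h_{2n+2} in the term
    -- of index n + 1; here Q * u is (q; q)_{n+1}.
    linear_combination (norm := (field_simp; subst hu hv; ring))
      -a * (b * a) * (1 - a * (t * q ^ 2)) * P * (Q * u)⁻¹ * hH

theorem tsum_qExpansionTerm_mul (hq : |q| < 1) (hX : |X| ≤ 1) (ha : |a| < 1) :
    ((1 + a) ^ 2 - 4 * X ^ 2 * a) * ∑' k, qExpansionTerm q X a k =
      (1 + a) * (1 - q * a ^ 2) * ∑' k, qExpansionTerm q X (a * q) k := by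
  have haq : |a * q| < 1 := by simpa using abs_mul_pow_lt_one hq ha 1
  have hs := ((summable_qExpansionTerm hq hX ha).hasSum.mul_left
    ((1 + a) ^ 2 - 4 * X ^ 2 * a)).sub
    ((summable_qExpansionTerm hq hX haq).hasSum.mul_left ((1 + a) * (1 - q * a ^ 2)))
  have hlim := (hs.tendsto_sum_nat).comp (tendsto_add_atTop_nat 1)
  obtain ⟨C, hC⟩ := exists_abs_coeff_le hq ha
  have hz := (summable_pow_mul_abs_qHermiteLower_even hq hX (abs_nonneg a) ha).tendsto_atTop_zero
  have hzC : Tendsto (fun n : ℕ => C * (|a| ^ n * |qHermiteLower q X (2 * n)|)) atTop (𝓝 0) := by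
    simpa using hz.const_mul C
  -- The coefficient bound is uniform in both indices, so one statement covers both boundary terms.
  have hzero : ∀ f m : ℕ → ℕ, Tendsto (fun n : ℕ => a ^ n *
      (qPochhammerInf (a * q ^ f n) q * (qPochhammerSelf q (m n))⁻¹) *
        qHermiteLower q X (2 * n)) atTop (𝓝 0) := by
    intro f m
    refine squeeze_zero_norm (fun n => ?_) hzC
    rw [Real.norm_eq_abs, abs_mul, abs_mul, abs_pow, mul_comm (|a| ^ n), mul_assoc]
    exact mul_le_mul_of_nonneg_right (hC _ _) (by positivity)
  have hqpow : Tendsto (fun n : ℕ => q ^ n) atTop (𝓝 0) :=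
    tendsto_pow_atTop_nhds_zero_of_abs_lt_one hq
  have htop : Tendsto (fun n : ℕ => 2 * n) atTop atTop :=
    tendsto_id.const_mul_atTop' two_pos
  have hf1 := (tendsto_const_nhds (x := (1 : ℝ))).sub
    ((hqpow.comp (tendsto_add_atTop_nat 2)).comp htop)
  have hf2 := (tendsto_const_nhds (x := (1 : ℝ))).sub
    ((hqpow.comp (tendsto_add_atTop_nat 1)).comp htop)
  have hR := ((hf1.mul hf2).mul_const (a ^ 2)).mul (hzero (fun n => n + 2) (fun n => n + 1))
  -- The shift by one makes the truncated n - 1 equal to n.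
  have hP := (hzero (fun n => n) (fun n => n - 1)).comp (tendsto_add_atTop_nat 1)
  have hlim0 := hR.sub hP
  rw [mul_zero, sub_zero] at hlim0
  refine sub_eq_zero.mp (tendsto_nhds_unique hlim (hlim0.congr fun n => ?_))
  exact (sum_qExpansionTerm_telescope hq X a n).symm

theorem tendsto_tsum_qExpansionTerm (hq : |q| < 1) (hX : |X| ≤ 1) (ha : |a| < 1) :
    Tendsto (fun n : ℕ => ∑' k, qExpansionTerm q X (a * q ^ n) k) atTop (𝓝 1) := by
  obtain ⟨C, hC⟩ := exists_abs_coeff_le hq ha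
  have hshift : ∀ n k : ℕ, a * q ^ n * q ^ (k + 1) = a * q ^ (n + (k + 1)) := fun n k => by ring
  -- Termwise limit of the series: only k = 0 survives, through 0^0 = 1.
  have h1 : ∑' k : ℕ, (0 : ℝ) ^ k * 1 * (qPochhammerSelf q k)⁻¹ * qHermiteLower q X (2 * k) = 1 := by
    rw [tsum_eq_single 0 fun k hk => by simp [hk]]
    simp [qPochhammerSelf, qHermiteLower]
  rw [← h1]
  refine tendsto_tsum_of_dominated_convergence
    ((summable_pow_mul_abs_qHermiteLower_even hq hX (abs_nonneg a) ha).mul_left C) (fun k => ?_)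
    (Eventually.of_forall fun n k => ?_)
  · have h0 : Tendsto (fun n : ℕ => a * q ^ n) atTop (𝓝 0) := by
      simpa using (tendsto_pow_atTop_nhds_zero_of_abs_lt_one hq).const_mul a
    have hA := (tendsto_qPochhammerInf_mul_pow hq ha).comp (tendsto_add_atTop_nat (k + 1))
    simp only [qExpansionTerm, hshift]
    exact (((h0.pow k).mul hA).mul_const _).mul_const _
  · rw [qExpansionTerm, hshift, mul_assoc (_ ^ k), Real.norm_eq_abs, abs_mul, abs_mul, abs_pow,
      mul_comm (|a * q ^ n| ^ k), mul_assoc]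
    refine mul_le_mul (hC _ _) ?_ (by positivity) ((abs_nonneg _).trans (hC 0 0))
    refine mul_le_mul_of_nonneg_right (pow_le_pow_left₀ (abs_nonneg _) ?_ k) (abs_nonneg _)
    rw [abs_mul, abs_pow]
    exact mul_le_of_le_one_right (abs_nonneg a) (pow_le_one₀ (abs_nonneg q) hq.le)

theorem tsum_qExpansionTerm_mul_prod (hq : |q| < 1) (hX : |X| ≤ 1) (ha : |a| < 1) (n : ℕ) :
    (∑' k, qExpansionTerm q X a k) *
        ((∏ k ∈ range n, ((1 + a * q ^ k) ^ 2 - 4 * X ^ 2 * (a * q ^ k))) *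
          ∏ k ∈ range n, (1 - a * q ^ k)) =
      (∏ j ∈ range (2 * n), (1 - a ^ 2 * q ^ j)) * ∑' k, qExpansionTerm q X (a * q ^ n) k := by
  induction n with
  | zero => simp
  | succ n ih =>
    have h := tsum_qExpansionTerm_mul hq hX (abs_mul_pow_lt_one hq ha n)
    rw [mul_assoc a, ← pow_succ] at h
    rw [show 2 * (n + 1) = 2 * n + 1 + 1 by ring]
    simp only [prod_range_succ]
    linear_combination ((1 + a * q ^ n) ^ 2 - 4 * X ^ 2 * (a * q ^ n)) * (1 - a * q ^ n) * ih +
      (∏ j ∈ range (2 * n), (1 - a ^ 2 * q ^ j)) * (1 - a * q ^ n) * h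

end Expansion

theorem four_mul_sq_qHermiteLower_arg {q : ℝ} (hq : |q| < 1) (x : ℝ) :
    4 * (x * √(1 - q) / 2) ^ 2 = (1 - q) * x ^ 2 := by
  have h1 : 0 ≤ 1 - q := by linarith [(abs_lt.mp hq).2]
  rw [div_pow, mul_pow, Real.sq_sqrt h1]
  ring

theorem qExpansionTerm_eq {q : ℝ} (hq : |q| < 1) (ρ x : ℝ) (k : ℕ) :
    qExpansionTerm q (x * √(1 - q) / 2) ρ k =
      ρ ^ k * qPochhammerInf (ρ * q ^ (k + 1)) q / qFactorial q k * qHermite q x (2 * k) := by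
  have hq1 := (abs_lt.mp hq).2
  have h1 : 0 < 1 - q := by linarith
  rw [qHermite_eq_qHermiteLower hq1, pow_mul (√(1 - q)), Real.sq_sqrt h1.le, qExpansionTerm,
    ← qFactorial_mul_pow]
  have := qFactorial_ne_zero hq k
  field_simp

theorem tsum_qExpansionTerm {q ρ x : ℝ} (hq : |q| < 1) (hρ : |ρ| < 1) (hx : x ∈ qSupport q)
    (hX : |x * √(1 - q) / 2| ≤ 1) :
    ∑' k, qExpansionTerm q (x * √(1 - q) / 2) ρ k =
      qPochhammerInf (ρ ^ 2) q / qPochhammerInf ρ q * ∏' k : ℕ, (qL q x ρ k)⁻¹ := by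
  have hL0 := tprod_qL_ne_zero hq hρ hx
  have hP0 := qPochhammerInf_ne_zero hq hρ
  have hL : ∀ k, (1 + ρ * q ^ k) ^ 2 - 4 * (x * √(1 - q) / 2) ^ 2 * (ρ * q ^ k) = qL q x ρ k :=
    fun k => by rw [four_mul_sq_qHermiteLower_arg hq, qL]; ring
  have htop : Tendsto (fun n : ℕ => 2 * n) atTop atTop :=
    tendsto_id.const_mul_atTop' two_pos
  have hleft := ((multipliable_qL hq x ρ).hasProd.tendsto_prod_nat.mul
    (tendsto_prod_qPochhammerInf hq ρ)).const_mul (∑' k, qExpansionTerm q (x * √(1 - q) / 2) ρ k)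
  have hright := ((tendsto_prod_qPochhammerInf hq (ρ ^ 2)).comp htop).mul
    (tendsto_tsum_qExpansionTerm hq hX hρ)
  have h := tendsto_nhds_unique hleft (hright.congr fun n => by
    simpa only [hL, Function.comp_apply] using (tsum_qExpansionTerm_mul_prod hq hX hρ n).symm)
  rw [(multipliable_qL hq x ρ).tprod_inv₀ hL0]
  field_simp
  linear_combination h

theorem mainTheorem3 (q ρ x : ℝ) (hq : |q| < 1) (hρ : |ρ| < 1) (hx : x ∈ qSupport q) :
    -- convergence of the infinite products, and non-vanishing of the denominators
    (∀ a : ℝ, Multipliable fun j : ℕ => 1 - a * q ^ j) ∧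
    (∀ k : ℕ, qFactorial q k ≠ 0) ∧
    qPochhammerInf ρ q ≠ 0 ∧
    (∀ k : ℕ, qL q x ρ k ≠ 0) ∧
    (Multipliable fun k : ℕ => qL q x ρ k) ∧
    (Multipliable fun k : ℕ => (qL q x ρ k)⁻¹) ∧
    -- the expansion
    HasSum
      (fun k : ℕ =>
        ρ ^ k * qPochhammerInf (ρ * q ^ (k + 1)) q / qFactorial q k * qHermite q x (2 * k))
      (qPochhammerInf (ρ ^ 2) q / qPochhammerInf ρ q * ∏' k : ℕ, (qL q x ρ k)⁻¹) := by
  have hX : |x * √(1 - q) / 2| ≤ 1 := by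
    rw [← sq_le_one_iff_abs_le_one]
    linarith [four_mul_sq_qHermiteLower_arg hq x, sq_le_of_mem_qSupport hq hx]
  refine ⟨multipliable_one_sub_mul_pow hq, qFactorial_ne_zero hq, qPochhammerInf_ne_zero hq hρ,
    fun k => (qL_pos hq hρ hx k).ne', multipliable_qL hq x ρ,
    (multipliable_qL hq x ρ).inv₀ (tprod_qL_ne_zero hq hρ hx), ?_⟩
  rw [← tsum_qExpansionTerm hq hρ hx hX]
  exact (summable_qExpansionTerm hq hX hρ).hasSum.congr_fun fun k =>
    (qExpansionTerm_eq hq ρ x k).symm
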